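/- Let $(R,\mathfrak m)$ be a commutative Noetherian local ring of prime characteristic $p$, and let $f:R\to R$, $f(r)=r^p$, be the Frobenius map. For $e>0$ let ${}^{f^e}R$ be the $(R,R)$-bimodule which is $R$ as an additive group, with left action $r\ast s=r^{p^e}s$ and right action $s\cdot r=sr$. For an $R$-module $M$ put $$\mathrm F^e(M)=M\otimes_R{}^{f^e}R,\qquad \widetilde{\mathrm F}^e(M)=\mathrm{Hom}_R({}^{f^e}R,M),\qquad M^*=\mathrm{Hom}_R(M,R),$$ where the tensor product and $\mathrm{Hom}_R({}^{f^e}R,M)$ are formed with respect to the left structure of ${}^{f^e}R$, and $\mathrm F^e(M)$ and $\widetilde{\mathrm F}^e(M)$ are $R$-modules through the right structure of ${}^{f^e}R$. Assume that $R$ is F-finite, i.e. that ${}^{f}R$ is a finitely generated left $R$-module. Then the following are equivalent: (a) $R$ is FPI, i.e. $\mathrm F^1(I)$ is an injective $R$-module for every injective $R$-module $I$; (b) for every integer $e>0$, the contravariant functors $M\mapsto \mathrm F^e(M)^{*}$ and $M\mapsto\widetilde{\mathrm F}^e(M^{*})$, from finitely generated $R$-modules to $R$-modules, are naturally isomorphic.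 -/

import Mathlib

open CategoryTheory

universe u

noncomputable section

/-- `R` is F-finite: `R`, as a left module over itself through the Frobenius `r ↦ r ^ p`,
is finitely generated. -/
def IsFFinite (R : Type u) [CommRing R] (p : ℕ) [ExpChar R p] : Prop :=
  (frobenius R p).Finite

/-- The `e`-th Peskine-Szpiro functor `F^e = - ⊗_R {}^{f^e}R` on `R`-modules, that is, base change
along the `e`-fold Frobenius `f^e : R → R`. The module structure of the values is the one given by
the factor `{}^{f^e}R` through ordinary multiplication. -/
def peskineSzpiro (R : Type u) [CommRing R] (p : ℕ) [ExpChar R p] (e : ℕ) :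
    ModuleCat.{u} R ⥤ ModuleCat.{u} R :=
  ModuleCat.extendScalars.{u} (iterateFrobenius R p e)

/-- The dual functor `Hom_R({}^{f^e}R, -)` of additive maps `θ : R → M` such that
`θ (r ^ (p ^ e) * s) = r • θ s`, with the module structure `(r • θ) s = θ (s * r)`. -/
def peskineSzpiroDual (R : Type u) [CommRing R] (p : ℕ) [ExpChar R p] (e : ℕ) :
    ModuleCat.{u} R ⥤ ModuleCat.{u} R :=
  ModuleCat.coextendScalars.{u} (iterateFrobenius R p e)

/-- The contravariant functor `(-)^* = Hom_R(-, R)` on `R`-modules. -/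
def dualFunctor (R : Type u) [CommRing R] : (ModuleCat.{u} R)ᵒᵖ ⥤ ModuleCat.{u} R where
  obj M := ModuleCat.of R (Module.Dual R M.unop)
  map g := ModuleCat.ofHom (Module.Dual.transpose g.unop.hom)

/-- `R` is FPI: the Frobenius functor `F = F^1` sends injective modules to injective modules. -/
def IsFPI (R : Type u) [CommRing R] (p : ℕ) [ExpChar R p] : Prop :=
  ∀ I : ModuleCat.{u} R, Module.Injective R I →
    Module.Injective R ((peskineSzpiro R p 1).obj I)

/-- The contravariant functor `M ↦ F^e(M)^*` on finitely generated `R`-modules. -/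
def frobeniusThenDual (R : Type u) [CommRing R] (p : ℕ) [ExpChar R p] (e : ℕ) :
    (FGModuleCat.{u} R)ᵒᵖ ⥤ ModuleCat.{u} R :=
  (ModuleCat.isFG.{u} R).ι.op ⋙ (peskineSzpiro R p e).op ⋙ dualFunctor R

/-- The contravariant functor `M ↦ Hom_R({}^{f^e}R, M^*)` on finitely generated `R`-modules. -/
def dualThenFrobeniusDual (R : Type u) [CommRing R] (p : ℕ) [ExpChar R p] (e : ℕ) :
    (FGModuleCat.{u} R)ᵒᵖ ⥤ ModuleCat.{u} R :=
  (ModuleCat.isFG.{u} R).ι.op ⋙ dualFunctor R ⋙ peskineSzpiroDual R p e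

end

/-!
For a ring homomorphism `g : R → S` write `ω_g` for the `S`-module `Hom_R(S, R)` (`relDual g`), and
let `f` be the Frobenius endomorphism of `R`.

*Both functors in terms of `ω`.* By adjunction the functors `M ↦ (S ⊗ M)^*` and
`M ↦ Hom_R(S, M^*)` are `Hom_R(M, S)` and `Hom_R(M, ω_g)`. So an isomorphism `ω_g ≃ S` of
`S`-modules induces a natural isomorphism between them (`dualExtendScalarsIso`), and evaluation at
`M = R` gives the converse (`relDualEquiv`). It remains to show that `R` is FPI if and only if
`ω_{f^e} ≃ R` for all `e > 0`.

*Injectives.* For `S` finite over the Noetherian ring `R` and `I` injective, the evaluation map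
`S ⊗ I → Hom_R(ω_g, I)` is bijective (`dualEval_bijective`).

If `ω_g ≃ S`, the right side is `Hom_R(S, I)`, which is injective over `S`
(`injective_extendScalars_obj`). Hence the natural isomorphism for `e = 1` makes `R` FPI.

If `R` is FPI, take `g = f` and for `I` the character module of `R`. The right side is then the
character module of `ω_f`, whose injectivity means that `ω_f` is flat
(`flat_relDual_of_injective`). Being finitely generated over a local ring, `ω_f` is free, say of
rank `t`, and by transitivity of coextension `ω_{f^e}` is free of rank `t ^ e`
(`relDual_iterateFrobenius`).

*The rank is one.* Localize at a minimal prime `P` of `R`. Since `P R_P` is nilpotent, for large `e`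
the module `f^e_* R` becomes a nonzero vector space of finite dimension `d` over the residue field
`k`, and its dual has length `d` times the length of the socle `Hom(k, R_P)`. Comparison with the
length `t ^ e * d` shows that `t ^ e` is this socle length, for all large `e`; as the socle is
nonzero, `t = 1` (`rank_relDual_frobenius`).
-/

open TensorProduct

/-! ### Evaluation into injective modules -/

/-- The evaluation map `A ⊗ I → Hom(Hom(A, R), I)`, `a ⊗ x ↦ (φ ↦ φ a • x)`. -/
noncomputable def dualEval (R A I : Type u) [CommRing R] [AddCommGroup A] [Module R A]
    [AddCommGroup I] [Module R I] : A ⊗[R] I →ₗ[R] (Module.Dual R A →ₗ[R] I) :=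
  dualTensorHom R (Module.Dual R A) I ∘ₗ (Module.Dual.eval R A).rTensor I

section
variable {R A B I : Type u} [CommRing R] [AddCommGroup A] [Module R A]
    [AddCommGroup B] [Module R B] [AddCommGroup I] [Module R I]

@[simp]
lemma dualEval_tmul (a : A) (x : I) (φ : Module.Dual R A) :
    dualEval R A I (a ⊗ₜ x) φ = φ a • x := by
  simp [dualEval, dualTensorHom_apply]

lemma dualEval_rTensor (v : A →ₗ[R] B) (w : A ⊗[R] I) (φ : Module.Dual R B) :
    dualEval R B I (v.rTensor I w) φ = dualEval R A I w (φ ∘ₗ v) := by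
  induction w with
  | zero => simp
  | tmul a x => simp
  | add a b ha hb => simp [ha, hb]

lemma dualEval_bijective_of_free [Module.Free R A] [Module.Finite R A] :
    Function.Bijective (dualEval R A I) := by
  have h1 : Function.Bijective (dualTensorHom R (Module.Dual R A) I) := dualTensorHom_bijective
  have h2 : Function.Bijective ((Module.Dual.eval R A).rTensor I) :=
    (LinearEquiv.rTensor I (Module.evalEquiv R A)).bijective
  exact h1.comp h2

/-- For a finite module `A` over a Noetherian ring and an injective module `I` the evaluation map is
bijective: both sides are right exact functors of `A`, and finite free modules are a direct check. -/
theorem dualEval_bijective [IsNoetherianRing R] [Module.Finite R A] [Module.Injective R I] :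
    Function.Bijective (dualEval R A I) := by
  -- A finite free presentation `R^m → R^n → A → 0`.
  obtain ⟨n, π, hπ⟩ := Module.Finite.exists_fin' R A
  obtain ⟨m, ρ, hρ⟩ := Module.Finite.exists_fin' R (LinearMap.ker π)
  set κ : (Fin m → R) →ₗ[R] (Fin n → R) := (LinearMap.ker π).subtype ∘ₗ ρ with hκ
  have hex : Function.Exact κ π := by
    rw [LinearMap.exact_iff, hκ, LinearMap.range_comp, LinearMap.range_eq_top.2 hρ]
    simp
  have πκ : π ∘ₗ κ = 0 := hex.linearMap_comp_eq_zero
  have hdπ : Function.Injective (Module.Dual.transpose (R := R) π) :=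
    LinearMap.dualMap_injective_of_surjective hπ
  constructor
  · rw [injective_iff_map_eq_zero]
    intro z hz
    obtain ⟨w, rfl⟩ := LinearMap.rTensor_surjective I hπ z
    -- `dualEval w` vanishes on the dual of `A`, the kernel of the transpose of `κ`, hence
    -- factors through the range of this transpose and extends to the whole dual.
    have hker : LinearMap.ker (Module.Dual.transpose (R := R) κ) ≤
        LinearMap.ker (dualEval R _ I w) := by
      intro ψ hψ
      have hψ' : ψ ∘ₗ κ = 0 := hψ
      have hle : LinearMap.ker π ≤ LinearMap.ker ψ := by
        intro y hy
        obtain ⟨y', rfl⟩ := (hex y).1 hy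
        exact LinearMap.congr_fun hψ' y'
      obtain ⟨φ, hφ⟩ : ∃ φ : Module.Dual R A, φ ∘ₗ π = ψ := by
        refine
          ⟨(LinearMap.ker π).liftQ ψ hle ∘ₗ (π.quotKerEquivOfSurjective hπ).symm, ?_⟩
        ext1 i
        ext
        simp only [LinearMap.comp_apply, LinearEquiv.coe_coe]
        erw [LinearMap.quotKerEquivOfSurjective_symm_apply]
        simp
      rw [LinearMap.mem_ker, ← hφ, ← dualEval_rTensor, hz, LinearMap.zero_apply]
    obtain ⟨h, hh⟩ := Module.Injective.out
      ((LinearMap.ker (Module.Dual.transpose (R := R) κ)).liftQ _ le_rfl)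
      (LinearMap.ker_eq_bot.1 (Submodule.ker_liftQ_eq_bot _ _ _ le_rfl))
      ((LinearMap.ker (Module.Dual.transpose (R := R) κ)).liftQ (dualEval R _ I w) hker)
    obtain ⟨v, rfl⟩ := (dualEval_bijective_of_free (R := R) (A := Fin m → R) (I := I)).2 h
    have : κ.rTensor I v = w := by
      apply (dualEval_bijective_of_free (R := R) (A := Fin n → R) (I := I)).1
      ext1 ψ
      rw [dualEval_rTensor]
      exact hh (Submodule.Quotient.mk ψ)
    rw [← this, ← LinearMap.comp_apply, ← LinearMap.rTensor_comp, πκ]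
    simp
  · -- A map on the dual of `A` extends to the dual of `R^n`, of which the dual of `A` is a submodule.
    intro g
    obtain ⟨h, hh⟩ := Module.Injective.out (Module.Dual.transpose (R := R) π) hdπ g
    obtain ⟨w, rfl⟩ := (dualEval_bijective_of_free (R := R) (A := Fin n → R) (I := I)).2 h
    refine ⟨π.rTensor I w, ?_⟩
    ext1 φ
    rw [dualEval_rTensor]
    exact hh φ
end

/-! ### The relative dual of a finite ring homomorphism and injective modules -/

section
variable {R S : Type u} [CommRing R] [CommRing S] (f : R →+* S)

/-- The `S`-module `Hom_R(S, R)` attached to a ring homomorphism `f : R → S`, with the action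
`(s • φ) t = φ (t * s)`. As a type it is definitionally the type of `R`-linear maps from `S` to `R`,
for `S` an `R`-module through `f`; the proofs below pass freely between the two. -/
noncomputable abbrev relDual : ModuleCat.{u} S :=
  (ModuleCat.coextendScalars.{u} f).obj (ModuleCat.of R R)

/-- Coextension of scalars preserves injective modules, being right adjoint to the exact functor
of restriction of scalars. -/
lemma injective_coextendScalars_obj (I : ModuleCat.{u} R) (hI : Module.Injective R I) :
    Module.Injective S ((ModuleCat.coextendScalars.{u} f).obj I) := by
  rw [Module.injective_iff_injective_object R I] at hI
  have := Injective.injective_of_adjoint (ModuleCat.restrictCoextendScalarsAdj.{u, u, u} f)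
    (ModuleCat.of R I)
  exact (Module.injective_iff_injective_object S _).2 this

variable {f}

/-- The `R`-module structure on `Hom_R(S, R)` given by its values is the restriction of the
`S`-module structure. -/
lemma smul_relDual (r : R)
    (φ : (ModuleCat.restrictScalars.{u} f).obj (ModuleCat.of S S) →ₗ[R] R) :
    (show relDual f from r • φ) = f r • (show relDual f from φ) := by
  apply ModuleCat.CoextendScalars.ext
  refine LinearMap.ext fun (s : S) => ?_
  exact (φ.map_smul r s).symm.trans (congrArg φ (mul_comm (f r) s))

lemma finite_relDual [IsNoetherianRing R] (hf : f.Finite) : Module.Finite S (relDual f) := by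
  let _ : Algebra R S := f.toAlgebra
  have : Module.Finite R S := hf
  have : IsNoetherian R (S →ₗ[R] R) := isNoetherian_of_isNoetherianRing_of_finite R _
  obtain ⟨s, hs⟩ := (inferInstance : Module.Finite R (S →ₗ[R] R)).1
  -- Generators over `R` also generate over `S`.
  refine ⟨⟨s, top_unique fun φ _ => ?_⟩⟩
  have hφ : (show S →ₗ[R] R from φ) ∈ Submodule.span R (s : Set (S →ₗ[R] R)) := hs ▸ trivial
  suffices ∀ ψ ∈ Submodule.span R (s : Set (S →ₗ[R] R)),
      (show relDual f from ψ) ∈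
        Submodule.span S (show Set (relDual f) from (s : Set (S →ₗ[R] R))) from this _ hφ
  intro ψ hψ
  induction hψ using Submodule.span_induction with
  | mem x hx => exact Submodule.subset_span hx
  | zero => exact Submodule.zero_mem _
  | add x y _ _ hx hy => exact Submodule.add_mem _ hx hy
  | smul r x _ hx =>
    rw [show (show relDual f from r • x) = f r • (show relDual f from x) from smul_relDual r x]
    exact Submodule.smul_mem _ _ hx

/-- If `Hom_R(S, R)` is free of rank one over `S`, then `S ⊗ I` is isomorphic to `Hom_R(S, I)` for
injective `I`, hence injective. -/
theorem injective_extendScalars_obj [IsNoetherianRing R] (hf : f.Finite)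
    (e : relDual f ≃ₗ[S] S) (I : ModuleCat.{u} R) (hI : Module.Injective R I) :
    Module.Injective S ((ModuleCat.extendScalars.{u} f).obj I) := by
  let _ : Algebra R S := f.toAlgebra
  have : Module.Finite R S := hf
  -- `e⁻¹`, with its values regarded as `R`-linear maps.
  let e' : S ≃ₗ[R] (S →ₗ[R] R) :=
    { toFun := fun s => (e.symm s : relDual f)
      invFun := fun φ => e (show relDual f from φ)
      left_inv := fun s => e.apply_symm_apply s
      right_inv := fun s => e.symm_apply_apply _
      map_add' := fun a b => e.symm.map_add a b
      map_smul' := fun r s => by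
        have : (e.symm (r • s) : relDual f) = f r • e.symm s := by rw [← map_smul]; rfl
        exact this.trans (smul_relDual r _).symm }
  -- `s ⊗ x ↦ (t ↦ e⁻¹(t)(s) • x)`, so far only additive; its `S`-linearity is checked below.
  let θ : S ⊗[R] I ≃+ (S →ₗ[R] I) :=
    ((LinearEquiv.ofBijective _ (dualEval_bijective (R := R) (A := S) (I := I))).trans
      (e'.symm.congrLeft I R)).toAddEquiv
  have hθ : ∀ (s t : S) (x : I), θ (s ⊗ₜ x) t = (e' t s) • x := fun s t x => dualEval_tmul _ _ _
  have he' : ∀ s t u : S, e' (t * s) u = e' t (u * s) := by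
    intro s t u
    have : e.symm (t * s) = s • e.symm t := by
      rw [← map_smul, smul_eq_mul, mul_comm]
    change (show S →ₗ[R] R from e.symm (t * s)) u = (show S →ₗ[R] R from e.symm t) (u * s)
    rw [this]
    rfl
  let Θ : (ModuleCat.extendScalars.{u} f).obj I ≃ₗ[S] (ModuleCat.coextendScalars.{u} f).obj I :=
    { toFun := fun z => θ z
      invFun := fun z => θ.symm z
      left_inv := fun z => θ.left_inv z
      right_inv := fun z => θ.right_inv z
      map_add' := fun a b => θ.map_add a b
      map_smul' := fun s (z : S ⊗[R] I) => by
        refine LinearMap.ext fun (t : S) => ?_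
        change θ (s • z) t = θ z (t * s)
        induction z with
        | zero => simp
        | tmul a x => rw [smul_tmul', hθ, hθ, he', smul_eq_mul, mul_comm]
        | add a b ha hb => rw [smul_add, map_add, map_add, LinearMap.add_apply, ha, hb]; rfl }
  have := injective_coextendScalars_obj f I hI
  exact ((Module.Baer.congr Θ).2 (Module.Baer.of_injective this)).injective

lemma injective_characterModule_self : Module.Injective R (CharacterModule R) :=
  Module.Flat.iff_characterModule_injective.1 inferInstance

/-- The module `S ⊗ R^c`, for the character module `R^c` of `R`, is the character module of
`Hom_R(S, R)`; its injectivity means that `Hom_R(S, R)` is flat. -/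
theorem flat_relDual_of_injective [IsNoetherianRing R] (hf : f.Finite)
    (h : Module.Injective S ((ModuleCat.extendScalars.{u} f).obj
      (ModuleCat.of R (CharacterModule R)))) :
    Module.Flat S (relDual f) := by
  let _ : Algebra R S := f.toAlgebra
  have : Module.Finite R S := hf
  have := injective_characterModule_self (R := R)
  rw [Module.Flat.iff_characterModule_injective]
  -- A linear map `g` into the character module of `R` corresponds to the character `φ ↦ g φ 1`.
  let κ : (Module.Dual R S →ₗ[R] CharacterModule R) ≃ₗ[R] CharacterModule (Module.Dual R S) :=
    CharacterModule.homEquiv.trans (CharacterModule.congr (TensorProduct.rid R _))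
  let θ : S ⊗[R] CharacterModule R ≃+ CharacterModule (Module.Dual R S) :=
    ((LinearEquiv.ofBijective _ (dualEval_bijective (R := R) (A := S)
      (I := CharacterModule R))).trans κ).toAddEquiv
  have hθ : ∀ (s : S) (c : CharacterModule R) (φ : Module.Dual R S),
      θ (s ⊗ₜ c) φ = c (φ s) := by
    intro s c φ
    change (dualEval R S (CharacterModule R) (s ⊗ₜ c) φ) 1 = _
    simp
  let Θ : (ModuleCat.extendScalars.{u} f).obj (ModuleCat.of R (CharacterModule R)) ≃ₗ[S]
      CharacterModule (relDual f) :=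
    { toFun := fun z => θ z
      invFun := fun z => θ.symm z
      left_inv := fun z => θ.left_inv z
      right_inv := fun z => θ.right_inv z
      map_add' := fun a b => θ.map_add a b
      map_smul' := fun s (z : S ⊗[R] CharacterModule R) => by
        refine DFunLike.ext _ _ fun (φ : relDual f) => ?_
        change θ (s • z) φ = θ z (s • φ)
        induction z with
        | zero => rw [smul_zero, map_zero]; rfl
        | tmul a x =>
          rw [smul_tmul', smul_eq_mul, mul_comm]
          exact (hθ _ _ _).trans (hθ _ _ (s • φ)).symm
        | add a b ha hb =>
          rw [smul_add, map_add, map_add]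
          exact congrArg₂ (· + ·) ha hb }
  exact ((Module.Baer.congr Θ).1 (Module.Baer.of_injective h)).injective

end

/-! ### Transitivity, and the natural isomorphism -/

section
variable {R S T : Type u} [CommRing R] [CommRing S] [CommRing T]

/-- `Hom_R(T, R) ≃ Hom_S(T, Hom_R(S, R))`: transitivity of coextension of scalars, by uniqueness of
right adjoints. -/
noncomputable def relDualComp (f : R →+* S) (g : S →+* T) :
    relDual (g.comp f) ≅ (ModuleCat.coextendScalars.{u} g).obj (relDual f) :=
  (((ModuleCat.restrictCoextendScalarsAdj.{u, u, u} (g.comp f)).rightAdjointUniq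
    (((ModuleCat.restrictCoextendScalarsAdj.{u, u, u} g).comp
      (ModuleCat.restrictCoextendScalarsAdj.{u, u, u} f)).ofNatIsoLeft
        (ModuleCat.restrictScalarsComp f g).symm)).app (ModuleCat.of R R))

/-- `Hom_S(T, S^n) ≃ Hom_S(T, S)^n` as `T`-modules. -/
noncomputable def coextendScalarsPi (g : S →+* T) (n : ℕ) :
    (ModuleCat.coextendScalars.{u} g).obj (ModuleCat.of S (Fin n → S)) ≃ₗ[T]
      (Fin n → relDual g) where
  toFun φ i := (LinearMap.proj i : (Fin n → S) →ₗ[S] S) ∘ₗ ModuleCat.CoextendScalars.equiv g _ φ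
  invFun φ := LinearMap.pi fun i => ModuleCat.CoextendScalars.equiv g _ (φ i)
  left_inv _ := rfl
  right_inv _ := rfl
  map_add' _ _ := rfl
  map_smul' _ _ := rfl

/-- Ranks of relative duals multiply along compositions. -/
lemma relDual_comp_free {f : R →+* S} {g : S →+* T} {m n : ℕ}
    (hf : Nonempty (relDual f ≃ₗ[S] (Fin m → S))) (hg : Nonempty (relDual g ≃ₗ[T] (Fin n → T))) :
    Nonempty (relDual (g.comp f) ≃ₗ[T] (Fin (m * n) → T)) := by
  obtain ⟨e⟩ := hf
  obtain ⟨e'⟩ := hg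
  let i : relDual f ≅ ModuleCat.of S (Fin m → S) := e.toModuleIso
  exact ⟨(relDualComp f g ≪≫ (ModuleCat.coextendScalars.{u} g).mapIso i).toLinearEquiv.trans <|
    (coextendScalarsPi g m).trans <| (LinearEquiv.piCongrRight fun _ => e').trans <|
    (LinearEquiv.curry T T (Fin m) (Fin n)).symm.trans
      (LinearEquiv.funCongrLeft T T finProdFinEquiv.symm)⟩

/-- An isomorphism `Hom_R(S, R) ≃ S` induces isomorphisms
`Hom_S(S ⊗ M, S) ≃ Hom_R(M, S) ≃ Hom_R(M, Hom_R(S, R)) ≃ Hom_R(S, Hom_R(M, R))`. -/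
noncomputable def dualExtendScalarsEquiv (f : R →+* S) (e : relDual f ≃ₗ[S] S)
    (M : ModuleCat.{u} R) :
    (dualFunctor S).obj (.op ((ModuleCat.extendScalars.{u} f).obj M)) ≃ₗ[S]
      (ModuleCat.coextendScalars.{u} f).obj ((dualFunctor R).obj (.op M)) :=
  letI := f.toAlgebra
  letI : Module S (S →ₗ[R] R) := (relDual f).isModule
  haveI hs : ∀ (φ : S →ₗ[R] R) (s t : S), (s • φ) t = φ (t * s) := fun _ _ _ => rfl
  haveI hr : ∀ (φ : S →ₗ[R] R) (r : R), algebraMap R S r • φ = r • φ := fun φ r => by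
    ext t
    rw [hs, LinearMap.smul_apply, ← map_smul, Algebra.smul_def, mul_comm]
  haveI : IsScalarTower R S (S →ₗ[R] R) := ⟨fun r s φ => by
    rw [← hr, Algebra.smul_def, mul_smul]⟩
  letI e₁ : (S →ₗ[R] R) ≃ₗ[S] S := e
  letI α : (S ⊗[R] M →ₗ[S] S) ≃ₗ[R] (M →ₗ[R] S) :=
     (LinearMap.liftBaseChangeEquiv S).symm.restrictScalars R
  letI β : (M →ₗ[R] S) ≃ₗ[R] (M →ₗ[R] S →ₗ[R] R) :=
    (e₁.symm.restrictScalars R).congrRight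
  letI γ : (M →ₗ[R] S →ₗ[R] R) ≃ₗ[R] (S →ₗ[R] M →ₗ[R] R) := LinearMap.lflip
  letI ε := α.trans (β.trans γ)
  { toFun := fun φ => ε φ
    invFun := fun φ => ε.symm φ
    left_inv := fun φ => ε.left_inv φ
    right_inv := fun φ => ε.right_inv φ
    map_add' := fun φ ψ => ε.map_add φ ψ
    map_smul' := fun s φ => by
      refine LinearMap.ext fun (t : S) => LinearMap.ext fun (m : M) => ?_
      let φ' : S ⊗[R] M →ₗ[S] S := φ
      change e₁.symm (s • φ' (1 ⊗ₜ[R] m)) t = e₁.symm (φ' (1 ⊗ₜ[R] m)) (t * s)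
      rw [map_smul, hs] }

/-- An isomorphism `Hom_R(S, R) ≃ S` makes `M ↦ (S ⊗ M)^*` and `M ↦ Hom_R(S, M^*)` naturally
isomorphic on all `R`-modules. -/
noncomputable def dualExtendScalarsIso (f : R →+* S) (e : relDual f ≃ₗ[S] S) :
    (ModuleCat.extendScalars.{u} f).op ⋙ dualFunctor S ≅
      dualFunctor R ⋙ ModuleCat.coextendScalars.{u} f :=
  NatIso.ofComponents (fun M => (dualExtendScalarsEquiv f e M.unop).toModuleIso) fun {M N} g => by
    ext φ
    refine LinearMap.ext fun (s : S) => LinearMap.ext fun (m : N.unop) => ?_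
    rfl

/-- An isomorphism `(S ⊗ M)^* ≃ Hom_R(S, M^*)` for `M = R` is an isomorphism `Hom_R(S, R) ≃ S`. -/
noncomputable def relDualEquiv (f : R →+* S) (i :
    (dualFunctor S).obj (.op ((ModuleCat.extendScalars.{u} f).obj (ModuleCat.of R R))) ≃ₗ[S]
      (ModuleCat.coextendScalars.{u} f).obj ((dualFunctor R).obj (.op (ModuleCat.of R R)))) :
    relDual f ≃ₗ[S] S :=
  letI := f.toAlgebra
  let α : (dualFunctor S).obj (.op ((ModuleCat.extendScalars.{u} f).obj (ModuleCat.of R R))) ≃ₗ[S]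
      S :=
    ((Algebra.TensorProduct.rid R S S).toLinearEquiv.symm.dualMap).trans
      (LinearMap.ringLmapEquivSelf S S S)
  let β : ModuleCat.of R R ≅ (dualFunctor R).obj (.op (ModuleCat.of R R)) :=
    (LinearMap.ringLmapEquivSelf R R R).symm.toModuleIso
  (((ModuleCat.coextendScalars.{u} f).mapIso β).toLinearEquiv.trans i.symm).trans α

end

/-! ### The socle at a minimal prime -/

section
variable {R : Type u} [CommRing R]

/-- Over a local ring `(A, m)`, if `M` is a nonzero finitely generated module with `m M = 0`
and `Hom_A(M, A) ≃ M^n`, then `n` is the length of the socle `Hom_A(A/m, A)`. -/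
lemma natCast_eq_length_of_dual_equiv {A M : Type*} [CommRing A] [IsLocalRing A] [AddCommGroup M]
    [Module A M] [Module.Finite A M] [Nontrivial M]
    (hM : ∀ a ∈ IsLocalRing.maximalIdeal A, ∀ x : M, a • x = 0) {n : ℕ}
    (e : Module.Dual A M ≃ₗ[A] (Fin n → M)) :
    (n : ℕ∞) = Module.length A (IsLocalRing.ResidueField A →ₗ[A] A) := by
  -- `M` is a vector space of dimension `d` over the residue field `k`. Its dual has length
  -- `d * length (Hom(k, A))`, and `M^n` has length `n * d`.
  have htors : Module.IsTorsionBySet A M (IsLocalRing.maximalIdeal A) :=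
    fun x a => hM a.1 a.2 x
  let _ : Module (IsLocalRing.ResidueField A) M := htors.module
  have : IsScalarTower A (IsLocalRing.ResidueField A) M := htors.isScalarTower
  have : Module.Finite (IsLocalRing.ResidueField A) M :=
    Module.Finite.of_restrictScalars_finite A _ _
  set d := Module.finrank (IsLocalRing.ResidueField A) M with hd
  have b : M ≃ₗ[A] (Fin d → IsLocalRing.ResidueField A) :=
    (Module.finBasis (IsLocalRing.ResidueField A) M).equivFun.restrictScalars A
  have : IsSimpleModule A (IsLocalRing.ResidueField A) :=
    isSimpleModule_iff_isCoatom.2 (Ideal.IsMaximal.out (I := IsLocalRing.maximalIdeal A))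
  have h1 : Module.length A M = d := by
    rw [b.length_eq, Module.length_pi]; simp
  have h2 : Module.length A (Module.Dual A M) =
      d * Module.length A (IsLocalRing.ResidueField A →ₗ[A] A) := by
    rw [(b.congrLeft A A).length_eq,
      ← (LinearMap.lsum A (fun _ : Fin d => IsLocalRing.ResidueField A) A).length_eq,
      Module.length_pi]
    simp
  have h3 := e.length_eq
  rw [h2, Module.length_pi, h1, mul_comm] at h3
  have hd0 : d ≠ 0 := Module.finrank_pos.ne'
  refine (ENat.mul_left_strictMono (a := (d : ℕ∞)) (by simpa using hd0) (by simp)).injective ?_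
  simpa using h3.symm

/-- The same count after localization at a prime `P`. The hypotheses say that `P` kills the
localization of `M`, and that `x₀` has nonzero image in it. -/
lemma natCast_eq_length_of_dual_equiv_localization [IsNoetherianRing R] {M : Type*}
    [AddCommGroup M] [Module R M] [Module.Finite R M] (P : Ideal R) [P.IsPrime]
    (hP : ∀ a ∈ P, ∀ x : M, ∃ s ∉ P, s • a • x = 0) (x₀ : M) (hx₀ : ∀ s ∉ P, s • x₀ ≠ 0) {n : ℕ}
    (e : Module.Dual R M ≃ₗ[R] (Fin n → M)) :
    (n : ℕ∞) = Module.length (Localization.AtPrime P)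
      (IsLocalRing.ResidueField (Localization.AtPrime P) →ₗ[Localization.AtPrime P]
        (Localization.AtPrime P)) := by
  have : Module.FinitePresentation R M := Module.finitePresentation_of_finite R M
  let A := Localization.AtPrime P
  let N := LocalizedModule P.primeCompl M
  let g := LocalizedModule.mkLinearMap P.primeCompl M
  have : Nontrivial N := by
    refine ⟨g x₀, 0, fun h => ?_⟩
    rw [← map_zero g, IsLocalizedModule.eq_iff_exists P.primeCompl g] at h
    obtain ⟨s, hs⟩ := h
    exact hx₀ s s.2 (hs.trans (smul_zero s))
  have hN : ∀ a ∈ IsLocalRing.maximalIdeal A, ∀ x : N, a • x = 0 := by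
    have key : ∀ a ∈ P, ∀ x : N, a • x = 0 := by
      intro a ha x
      induction x using LocalizedModule.induction_on with
      | h m s =>
      obtain ⟨t, ht, h⟩ := hP a ha m
      rw [LocalizedModule.smul'_mk, ← LocalizedModule.zero_mk s, LocalizedModule.mk_eq]
      exact ⟨⟨t, ht⟩, by simp [Submonoid.smul_def, smul_comm _ s.1, h]⟩
    intro a ha x
    rw [← Localization.AtPrime.map_eq_maximalIdeal] at ha
    induction ha using Submodule.span_induction with
    | mem y hy =>
      obtain ⟨r, hr, rfl⟩ := hy
      rw [algebraMap_smul]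
      exact key r hr x
    | zero => simp
    | add y z _ _ hy hz => simp [add_smul, hy, hz]
    | smul c y _ hy => rw [smul_assoc, hy, smul_zero]
  -- `e` localizes, since duals of finitely presented modules commute with localization.
  let G := IsLocalizedModule.mapExtendScalars P.primeCompl g (Algebra.linearMap R A) A
  let H : (Fin n → M) →ₗ[R] (Fin n → N) := LinearMap.pi fun i => g ∘ₗ LinearMap.proj i
  have : IsLocalizedModule P.primeCompl H := inferInstance
  have e' : Module.Dual A N ≃ₗ[A] (Fin n → N) :=
    IsLocalizedModule.mapEquiv P.primeCompl G H A e
  exact natCast_eq_length_of_dual_equiv hN e'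

/-- A minimal prime `P` of a Noetherian ring is associated, so `R_P` has nonzero socle. -/
lemma nontrivial_socle_localization [IsNoetherianRing R] (P : Ideal R) [P.IsPrime]
    (hP : P ∈ minimalPrimes R) :
    Nontrivial (IsLocalRing.ResidueField (Localization.AtPrime P) →ₗ[Localization.AtPrime P]
        (Localization.AtPrime P)) := by
  let A := Localization.AtPrime P
  have hP' : P ∈ associatedPrimes R R := by
    apply Module.associatedPrimes.minimalPrimes_annihilator_subset_associatedPrimes R R
    rwa [Module.annihilator_eq_bot.2 inferInstance]
  obtain ⟨-, x, hx⟩ := isAssociatedPrime_iff.1 hP'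
  have hx' : ∀ r, r ∈ P ↔ r * x = 0 := fun r => by
    rw [hx]; simp
  have hmax : IsLocalRing.maximalIdeal A ≤
      LinearMap.ker (LinearMap.toSpanSingleton A A (algebraMap R A x)) := by
    rw [← Localization.AtPrime.map_eq_maximalIdeal, Ideal.map_le_iff_le_comap]
    intro a ha
    change algebraMap R A a * algebraMap R A x = 0
    rw [← map_mul, (hx' a).1 ha, map_zero]
  refine ⟨(IsLocalRing.maximalIdeal A).liftQ _ hmax, 0, fun h => ?_⟩
  have h1 := LinearMap.congr_fun h (Submodule.Quotient.mk 1)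
  replace h1 : (1 : A) * algebraMap R A x = 0 := h1
  rw [one_mul, IsLocalization.map_eq_zero_iff P.primeCompl] at h1
  obtain ⟨s, hs⟩ := h1
  exact s.2 ((hx' s).2 hs)

/-- The maximal ideal of the localization at a minimal prime is nilpotent; hence the uniform exponent
`N`. -/
lemma exists_mul_pow_eq_zero_of_mem_minimalPrimes [IsNoetherianRing R] (P : Ideal R) [P.IsPrime]
    (hP : P ∈ minimalPrimes R) : ∃ N : ℕ, ∀ a ∈ P, ∃ s ∉ P, s * a ^ N = 0 := by
  let A := Localization.AtPrime P
  have hsub : Subsingleton (PrimeSpectrum A) :=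
    IsLocalization.subsingleton_primeSpectrum_of_mem_minimalPrimes P hP A
  obtain ⟨N, hN⟩ := IsNoetherianRing.isNilpotent_nilradical A
  refine ⟨N, fun a ha => ?_⟩
  have hmem : algebraMap R A a ∈ nilradical A := by
    rw [mem_nilradical, nilpotent_iff_mem_prime]
    intro J hJ
    have : J = IsLocalRing.maximalIdeal A :=
      congrArg PrimeSpectrum.asIdeal (Subsingleton.elim (⟨J, hJ⟩ : PrimeSpectrum A)
        (IsLocalRing.closedPoint A))
    rw [this, ← Localization.AtPrime.map_eq_maximalIdeal]
    exact Ideal.mem_map_of_mem _ ha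
  have h0 : algebraMap R A (a ^ N) = 0 := by
    have := Ideal.pow_mem_pow hmem N
    rwa [hN, Ideal.zero_eq_bot, Ideal.mem_bot, ← map_pow] at this
  obtain ⟨s, hs⟩ := (IsLocalization.map_eq_zero_iff P.primeCompl A _).1 h0
  exact ⟨s, s.2, hs⟩

end

/-! ### Iterates of the Frobenius endomorphism -/

section
variable {R : Type u} [CommRing R] {p : ℕ} [ExpChar R p]

lemma IsFFinite.finite_iterateFrobenius
    (hR : IsFFinite R p) (e : ℕ) : (iterateFrobenius R p e).Finite := by
  induction e with
  | zero => rw [iterateFrobenius_zero]; exact RingHom.Finite.id R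
  | succ e ih =>
    have : iterateFrobenius R p (e + 1) =
        (iterateFrobenius R p e).comp (frobenius R p) := by
      ext x; simp [iterateFrobenius_def, frobenius_def, ← pow_mul, pow_succ']
    rw [this]
    exact ih.comp hR

lemma relDual_iterateFrobenius {t : ℕ}
    (h : Nonempty (relDual (frobenius R p) ≃ₗ[R] (Fin t → R)))
    (e : ℕ) : Nonempty (relDual (iterateFrobenius R p (e + 1)) ≃ₗ[R] (Fin (t ^ (e + 1)) → R)) := by
  induction e with
  | zero => rwa [zero_add, iterateFrobenius_one, pow_one]
  | succ e ih =>
    have : iterateFrobenius R p (e + 1 + 1) =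
        (frobenius R p).comp (iterateFrobenius R p (e + 1)) := by
      ext x; simp [iterateFrobenius_def, frobenius_def, ← pow_mul, pow_succ]
    rw [this, pow_succ]
    exact relDual_comp_free ih h

/-- If `Hom_R(S, R)` is free over `S` of rank `n`, and the localization of `S` at a prime `P` of `R`
is a nonzero vector space over the residue field, then `n` is the length of the socle of `R_P`.
The rings `R` and `S` are kept apart so that, for an endomorphism of one ring, the module structure
through `f` is not confused with multiplication. -/
lemma natCast_eq_length_of_relDual {R S : Type u} [CommRing R] [CommRing S] [IsNoetherianRing R]
    {f : R →+* S} (hf : f.Finite) (P : Ideal R) [P.IsPrime] (hP : ∀ a ∈ P, ∃ s ∉ P, f (s * a) = 0)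
    (hP' : ∀ s ∉ P, f s ≠ 0) {n : ℕ} (i : relDual f ≃ₗ[S] (Fin n → S)) :
    (n : ℕ∞) = Module.length (Localization.AtPrime P)
      (IsLocalRing.ResidueField (Localization.AtPrime P) →ₗ[Localization.AtPrime P]
        (Localization.AtPrime P)) := by
  let _ := f.toAlgebra
  have : Module.Finite R S := hf
  let i' : Module.Dual R S ≃ₗ[R] (Fin n → S) :=
    { toFun := fun φ => i φ
      invFun := fun v => i.symm v
      left_inv := fun φ => i.symm_apply_apply φ
      right_inv := fun φ => i.apply_symm_apply φ
      map_add' := fun φ ψ => i.map_add φ ψ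
      map_smul' := fun r φ => (congrArg i (smul_relDual r φ)).trans (i.map_smul (f r) φ) }
  refine natCast_eq_length_of_dual_equiv_localization P ?_ (1 : S) ?_ i'
  · intro a ha x
    obtain ⟨s, hs, h0⟩ := hP a ha
    refine ⟨s, hs, ?_⟩
    rw [smul_smul, Algebra.smul_def]
    exact (congrArg (· * x) h0).trans (zero_mul x)
  · intro s hs h0
    rw [Algebra.smul_def, mul_one] at h0
    exact hP' s hs h0

/-- If `Hom_R(f_* R, R)` is free over `f_* R`, then its rank is one. This follows by comparing the
ranks of all iterates at a minimal prime: for all large `e` the localization of `f^e_* R` is a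
vector space over the residue field, so that the rank `t ^ e` of its dual equals the length of the
socle of the localization, which is positive and does not depend on `e`. -/
theorem rank_relDual_frobenius [IsNoetherianRing R] [Nontrivial R] (hp : p.Prime)
    (hR : IsFFinite R p) {t : ℕ}
    (h : Nonempty (relDual (frobenius R p) ≃ₗ[R] (Fin t → R))) : t = 1 := by
  obtain ⟨P, hP⟩ := (Ideal.nonempty_minimalPrimes (I := (⊥ : Ideal R)) bot_ne_top)
  have := hP.isPrime
  obtain ⟨N, hN⟩ := exists_mul_pow_eq_zero_of_mem_minimalPrimes P hP
  have key : ∀ e, N ≤ e → ((t ^ (e + 1) : ℕ) : ℕ∞) = Module.length (Localization.AtPrime P)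
      (IsLocalRing.ResidueField (Localization.AtPrime P) →ₗ[Localization.AtPrime P]
        (Localization.AtPrime P)) := by
    intro e he
    obtain ⟨i⟩ := relDual_iterateFrobenius h e
    have hfin := hR.finite_iterateFrobenius (e + 1)
    have hq : N ≤ p ^ (e + 1) :=
      he.trans ((Nat.le_succ e).trans (Nat.lt_pow_self hp.one_lt).le)
    refine natCast_eq_length_of_relDual hfin P ?_ ?_ i
    · intro a ha
      obtain ⟨s, hs, h0⟩ := hN a ha
      refine ⟨s, hs, ?_⟩
      -- `s ^ q * a ^ q = 0` for `q = p ^ (e + 1)`, since `q ≥ N` and `q ≥ 1`.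
      obtain ⟨c, hc⟩ := Nat.exists_eq_add_of_le hq
      obtain ⟨d, hd⟩ := Nat.exists_eq_succ_of_ne_zero (pow_ne_zero (e + 1) hp.ne_zero)
      rw [iterateFrobenius_def, mul_pow, hc, pow_add a, ← hc, hd, pow_succ]
      linear_combination s ^ d * a ^ c * h0
    · intro s hs h0
      rw [iterateFrobenius_def] at h0
      exact hs (‹P.IsPrime›.mem_of_pow_mem _ (h0 ▸ P.zero_mem))
  have h1 := (key N le_rfl).trans (key (N + 1) (Nat.le_succ N)).symm
  rw [Nat.cast_inj] at h1
  have h0 : t ≠ 0 := by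
    rintro rfl
    have := nontrivial_socle_localization P hP
    have h2 := key N le_rfl
    rw [zero_pow (Nat.succ_ne_zero N), Nat.cast_zero, eq_comm, Module.length_eq_zero_iff] at h2
    exact not_subsingleton _ h2
  have h2 : t ≤ 1 := by
    by_contra! ht
    exact (Nat.pow_lt_pow_right ht (Nat.lt_succ_self (N + 1))).ne h1
  omega

end

theorem mainTheorem2 (R : Type u) [CommRing R] [IsLocalRing R] [IsNoetherianRing R]
    (p : ℕ) [Fact p.Prime] [CharP R p] (hR : IsFFinite R p) :
    IsFPI R p ↔
      ∀ e : ℕ, 0 < e → Nonempty (frobeniusThenDual R p e ≅ dualThenFrobeniusDual R p e) := by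
  constructor
  · intro h e he
    have hflat : Module.Flat R (relDual (frobenius R p)) := by
      refine flat_relDual_of_injective hR ?_
      have := h (ModuleCat.of R (CharacterModule R)) injective_characterModule_self
      rwa [peskineSzpiro, iterateFrobenius_one] at this
    have := finite_relDual (f := frobenius R p) hR
    have : Module.Free R (relDual (frobenius R p)) := Module.free_of_flat_of_isLocalRing
    have i : relDual (frobenius R p) ≃ₗ[R] (Fin _ → R) := (Module.finBasis R _).equivFun
    rw [rank_relDual_frobenius Fact.out hR ⟨i⟩] at i
    obtain ⟨e, rfl⟩ := Nat.exists_eq_succ_of_ne_zero he.ne'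
    obtain ⟨j⟩ := relDual_iterateFrobenius ⟨i⟩ e
    rw [one_pow] at j
    exact ⟨Functor.isoWhiskerLeft (ModuleCat.isFG.{u} R).ι.op
      (dualExtendScalarsIso (iterateFrobenius R p (e + 1))
        (j.trans (LinearEquiv.funUnique (Fin 1) R R)))⟩
  · intro h I hI
    obtain ⟨i⟩ := h 1 one_pos
    have j := relDualEquiv (iterateFrobenius R p 1) (i.app (.op (FGModuleCat.of R R))).toLinearEquiv
    exact injective_extendScalars_obj (hR.finite_iterateFrobenius 1) j I hI
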